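/- Let $\mathcal X\subset\mathbb R^d$ and $A\subset\mathbb R^m$ be finite sets (states and actions), $r:\mathcal X\times A\times\mathcal X\to\mathbb R$ a reward function, $0<\alpha<1$, and let $\mathcal P(x,a)=\{\mathbb P^{(1)}(x,a),\dots,\mathbb P^{(N)}(x,a)\}$ be a finite set of probability measures on $\mathcal X$ for every $(x,a)\in\mathcal X\times A$. A policy is a sequence $\mathbf a=(a_t)_{t\ge 0}$ of maps $a_t:\mathcal X\to A$; $\mathcal A$ is the set of policies. Let $\Omega=\mathcal X^{\{0,1,2,\dots\}}$ with the product $\sigma$-algebra and coordinate process $(X_t)_{t\ge0}$. For $x\in\mathcal X$ and $\mathbf a\in\mathcal A$ let $\mathfrak P_{x,\mathbf a}$ be the set of all laws $\delta_x\otimes\mathbb P_0\otimes\mathbb P_1\otimes\cdots$ on $\Omega$, where $\mathbb P_t(y)\in\mathcal P(y,a_t(y))$ for all $t\ge 0$, $y\in\mathcal X$ (that is, $X_0=x$ and $X_{t+1}$ has conditional law $\mathbb P_t(X_t)$ given $X_0,\dots,X_t$). Define $$V(x)=\sup_{\mathbf a\in\mathcal A}\ \inf_{\mathbb P\in\mathfrak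 P_{x,\mathbf a}}\mathbb E_{\mathbb P}\Big[\sum_{t=0}^\infty\alpha^t r(X_t,a_t(X_t),X_{t+1})\Big],\qquad Q^*(x,a)=\inf_{\mathbb P\in\mathcal P(x,a)}\mathbb E_{Y\sim\mathbb P}\big[r(x,a,Y)+\alpha V(Y)\big].$$ Robust $Q$-learning: fix $x_0\in\mathcal X$, a policy $\mathbf a\in\mathcal A$, deterministic rates $(\widetilde\gamma_t)_{t\ge0}\subseteq[0,1]$ and an arbitrary $Q_0:\mathcal X\times A\to\mathbb R$. Set $X_0=x_0$. At each time $t=0,1,\dots$, choose, as a function of $X_0,\dots,X_t$ (ties being broken in any way), an index $$k_t^*\in\operatorname*{argmin}_{k=1,\dots,N}\mathbb E_{Y\sim\mathbb P^{(k)}(X_t,a_t(X_t))}\Big[r(X_t,a_t(X_t),Y)+\alpha\max_{b\in A}Q_t(Y,b)\Big],$$ sample $X_{t+1}\sim\mathbb P^{(k_t^*)}(X_t,a_t(X_t))$, and put, for all $(x,a)\in\mathcal X\times A$, $$Q_{t+1}(x,a)=\begin{cases}(1-\widetilde\gamma_t)Q_t(x,a)+\widetilde\gamma_t\big(r(x,a,X_{t+1})+\alpha\max_{b\in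 A}Q_t(X_{t+1},b)\big)&\text{if }(x,a)=(X_t,a_t(X_t)),\\ Q_t(x,a)&\text{otherwise.}\end{cases}$$ Let $\mathbb P_{x_0,\mathbf a}$ be the law on $\Omega$ of the states $(X_t)_{t\ge0}$ so generated, and let $\gamma_t(x,a,X_t)=\mathbf 1_{\{(x,a)=(X_t,a_t(X_t))\}}\widetilde\gamma_t$. **Theorem 3.1.** Suppose that, $\mathbb P_{x_0,\mathbf a}$-almost surely, $$\sum_{t=0}^\infty\gamma_t(x,a,X_t)=\infty\quad\text{and}\quad\sum_{t=0}^\infty\gamma_t^2(x,a,X_t)<\infty\qquad\text{for all }(x,a)\in\mathcal X\times A.$$ Then for all $(x,a)\in\mathcal X\times A$, $$\lim_{t\to\infty}Q_t(x,a)=Q^*(x,a)\qquad\mathbb P_{x_0,\mathbf a}\text{-almost surely.}$$ -/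

import Mathlib

open MeasureTheory ProbabilityTheory Filter Topology

namespace RobustQ

noncomputable section

/-- The data of the control problem: the `N` candidate transition probabilities `P k x a` for each
state-action pair `(x, a)`, the reward function `r` and the discount factor `α`. -/
structure Model (X A : Type*) [MeasurableSpace X] (N : ℕ) where
  P : Fin N → X → A → ProbabilityMeasure X
  r : X → A → X → ℝ
  α : ℝ

/-- Admissible (deterministic, Markovian, time-dependent) policies `(a_t)`; the action taken at
time `t` is `a t (X_t)`. As the state space carries the discrete `σ`-algebra, measurability
of the maps `a t` is automatic. -/
abbrev Policy (X A : Type*) := ℕ → X → A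

section Law

variable {X : Type*} [Finite X] [MeasurableSpace X] [DiscreteMeasurableSpace X]

/-- A family of probability measures indexed by the histories `(x_0, …, x_t)`, as a kernel. -/
def historyKernel (p : (t : ℕ) → (Finset.Iic t → X) → ProbabilityMeasure X) (t : ℕ) :
    Kernel (Finset.Iic t → X) X :=
  Kernel.ofFunOfCountable fun h => (p t h : Measure X)

instance (p : (t : ℕ) → (Finset.Iic t → X) → ProbabilityMeasure X) (t : ℕ) :
    IsMarkovKernel (historyKernel p t) :=
  ⟨fun h => inferInstanceAs (IsProbabilityMeasure (p t h : Measure X))⟩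

/-- The law `δ_x ⊗ p_0 ⊗ p_1 ⊗ ⋯` on `Ω = X^ℕ` of the process that starts in `x` and whose state at
time `t + 1` is drawn from `p t (x_0, …, x_t)`. The state process is `X_t ω = ω t`. -/
def pathLaw (x : X) (p : (t : ℕ) → (Finset.Iic t → X) → ProbabilityMeasure X) :
    Measure (ℕ → X) :=
  Kernel.trajMeasure (X := fun _ => X) (Measure.dirac x) (historyKernel p)

end Law

section Problem

variable {X A : Type*} [MeasurableSpace X] {N : ℕ}

/-- The ambiguity set `{P^(1)(x,a), …, P^(N)(x,a)}`. -/
def ambiguitySet (M : Model X A N) (x : X) (a : A) : Set (ProbabilityMeasure X) :=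
  Set.range fun k => M.P k x a

variable [Finite X] [DiscreteMeasurableSpace X]

/-- The admissible laws on `X^ℕ` for the initial state `x` and the policy `a`: all products
`δ_x ⊗ p_0 ⊗ p_1 ⊗ ⋯` where `p_t` depends on the current state only and `p_t(y)` lies in the
ambiguity set of `(y, a_t(y))`. -/
def admissibleLaws (M : Model X A N) (x : X) (a : Policy X A) : Set (Measure (ℕ → X)) :=
  {μ | ∃ p : ℕ → X → ProbabilityMeasure X,
    (∀ t y, p t y ∈ ambiguitySet M y (a t y)) ∧
    μ = pathLaw x fun t h => p t (h ⟨t, Finset.mem_Iic.2 le_rfl⟩)}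

/-- The robust value function
`V(x) = sup_a inf_μ E_μ[∑_t α^t r(X_t, a_t(X_t), X_{t+1})]`. -/
def value (M : Model X A N) (x : X) : ℝ :=
  ⨆ a : Policy X A, ⨅ μ : admissibleLaws M x a,
    ∫ ω, ∑' t : ℕ, M.α ^ t * M.r (ω t) (a t (ω t)) (ω (t + 1)) ∂(μ : Measure (ℕ → X))

/-- The robust optimal `Q`-function
`Q^*(x, a) = inf_μ E_μ[r(x, a, X_1) + α V(X_1)]`, the infimum being over the ambiguity set. -/
def Qstar (M : Model X A N) (x : X) (a : A) : ℝ :=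
  ⨅ μ : ambiguitySet M x a, ∫ y, (M.r x a y + M.α * value M y) ∂((μ : ProbabilityMeasure X) : Measure X)

end Problem

section Algorithm

variable {X A : Type*} [MeasurableSpace X] {N : ℕ}

/-- The one-step target `r(x, a, y) + α max_b q(y, b)`. -/
def target (M : Model X A N) (q : X → A → ℝ) (x : X) (a : A) (y : X) : ℝ :=
  M.r x a y + M.α * ⨆ b : A, q y b

/-- `k` minimises the expected one-step target among the indices `1, …, N`. -/
def IsWorstIndex (M : Model X A N) (q : X → A → ℝ) (x : X) (a : A) (k : Fin N) : Prop :=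
  ∀ j : Fin N, ∫ y, target M q x a y ∂(M.P k x a : Measure X) ≤
    ∫ y, target M q x a y ∂(M.P j x a : Measure X)

open Classical in
/-- The iterates `Q_t` of the algorithm along the trajectory `ω`, for the policy `a`, the learning
rates `γ` and the initialisation `Q₀`. Here `Q_t` depends on `ω 0, …, ω t` only. -/
def Qiter (M : Model X A N) (a : Policy X A) (γ : ℕ → ℝ) (Q₀ : X → A → ℝ) (ω : ℕ → X) :
    ℕ → X → A → ℝ
  | 0 => Q₀
  | t + 1 => fun x b =>
      if (x, b) = (ω t, a t (ω t)) then
        (1 - γ t) * Qiter M a γ Q₀ ω t x b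
          + γ t * target M (Qiter M a γ Q₀ ω t) x b (ω (t + 1))
      else Qiter M a γ Q₀ ω t x b

/-- `k` is a rule by which the algorithm started in `x₀` may select the indices `k_t^*`: at every
time `t`, on the basis of the states `X_0, …, X_t` visited so far, it picks a minimiser of the
expected one-step target at the current pair `(X_t, a_t(X_t))`. Ties may be broken in any way. -/
def IsSelectionRule (M : Model X A N) (x₀ : X) (a : Policy X A) (γ : ℕ → ℝ) (Q₀ : X → A → ℝ)
    (k : (t : ℕ) → (Finset.Iic t → X) → Fin N) : Prop :=
  ∀ ω : ℕ → X, ω 0 = x₀ → ∀ t : ℕ,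
    IsWorstIndex M (Qiter M a γ Q₀ ω t) (ω t) (a t (ω t)) (k t fun i => ω i)

/-- The law `P_{x₀,a}` of the states sampled by the algorithm: `X_0 = x₀`, and given
`X_0, …, X_t` the next state is drawn from `P^(k_t^*)(X_t, a_t(X_t))`. -/
def algorithmLaw [Finite X] [DiscreteMeasurableSpace X] (M : Model X A N) (x₀ : X)
    (a : Policy X A) (k : (t : ℕ) → (Finset.Iic t → X) → Fin N) : Measure (ℕ → X) :=
  pathLaw x₀ fun t h =>
    M.P (k t h) (h ⟨t, Finset.mem_Iic.2 le_rfl⟩) (a t (h ⟨t, Finset.mem_Iic.2 le_rfl⟩))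

open Classical in
/-- The effective learning rate `γ_t(x, b, y) = 1_{(x, b) = (y, a_t(y))} γ_t`, used with
`y = X_t`. -/
def learningRate (a : Policy X A) (γ : ℕ → ℝ) (t : ℕ) (x : X) (b : A) (y : X) : ℝ :=
  if (x, b) = (y, a t y) then γ t else 0

end Algorithm

end

end RobustQ

/-! Robust Q-learning is asynchronous stochastic approximation of the fixed point of a sup-norm
contraction. Write `z_t = Q_t - Q^*`. Each entry obeys `z_{t+1} = (1 - g) z_t + g (h + w)`, where
`g` is the effective rate, `h` is the robust Bellman operator at `Q_t` minus `Q^*`, and `w` is the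
sampled target minus its worst-case mean.

Drift: `value_eq_iSup_Qstar` makes `Q^*` a fixed point of the robust Bellman operator, an
`α`-contraction, so `|h| ≤ α sup |z_t|`. The identity comes from a verification argument: nature's
worst response holds every policy down to the Bellman solution, and the greedy policy secures it.

Noise: the next state is drawn from the minimising measure, so at the visited pair the target has
conditional mean equal to the worst-case mean; elsewhere `g = 0`. Hence `∑ g w` is a martingale. Its
increments are bounded by a constant times `γ_t`, with `∑ γ_t² < ∞`, so it converges almost surely
(`ae_tendsto_noiseSum`).

Path by path, `tendsto_zero_of_asynchronous_contraction` then gives `z_t → 0`. -/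

namespace RobustQ

/-! ### Deterministic asynchronous stochastic approximation -/

/-- A nonnegative sequence that is eventually damped by factors `1 - g t` with `∑ g = ∞` tends
to zero. -/
lemma tendsto_zero_of_le_one_sub_mul {u g : ℕ → ℝ} (hu : ∀ t, 0 ≤ u t)
    (hsum : Tendsto (fun n => ∑ t ∈ Finset.range n, g t) atTop atTop)
    (h : ∀ᶠ t in atTop, u (t + 1) ≤ (1 - g t) * u t) : Tendsto u atTop (𝓝 0) := by
  obtain ⟨T, hT⟩ := eventually_atTop.1 h
  -- Since `1 - g ≤ exp (-g)`, the product of `u n` with `exp (∑ g)` does not increase after `T`.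
  have key : ∀ n ≥ T, u n * Real.exp (∑ t ∈ Finset.range n, g t)
      ≤ u T * Real.exp (∑ t ∈ Finset.range T, g t) := by
    intro n hn
    induction n, hn using Nat.le_induction with
    | base => exact le_rfl
    | succ n hn ih =>
      refine le_trans ?_ ih
      rw [Finset.sum_range_succ, Real.exp_add]
      have h1 : u (n + 1) ≤ Real.exp (-g n) * u n :=
        (hT n hn).trans (mul_le_mul_of_nonneg_right (by
          have := Real.add_one_le_exp (-g n); linarith) (hu n))
      calc u (n + 1) * (Real.exp (∑ t ∈ Finset.range n, g t) * Real.exp (g n))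
          ≤ (Real.exp (-g n) * u n) * (Real.exp (∑ t ∈ Finset.range n, g t) * Real.exp (g n)) := by
            gcongr
        _ = (Real.exp (-g n) * Real.exp (g n)) *
              (u n * Real.exp (∑ t ∈ Finset.range n, g t)) := by ring
        _ = u n * Real.exp (∑ t ∈ Finset.range n, g t) := by
            rw [← Real.exp_add]; simp
  have hlim : Tendsto (fun n => u T * Real.exp (∑ t ∈ Finset.range T, g t) *
      Real.exp (-∑ t ∈ Finset.range n, g t)) atTop (𝓝 0) := by
    simpa using (Real.tendsto_exp_neg_atTop_nhds_zero.comp hsum).const_mul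
      (u T * Real.exp (∑ t ∈ Finset.range T, g t))
  refine squeeze_zero' (Eventually.of_forall hu) ?_ hlim
  filter_upwards [eventually_ge_atTop T] with n hn
  rw [Real.exp_neg, ← div_eq_mul_inv, le_div_iff₀ (Real.exp_pos _)]
  exact key n hn

/-- The excess `max (|y t| - B) 0` is damped by the factor `1 - g t` at each step. -/
lemma eventually_abs_le_add_of_averaging {y g : ℕ → ℝ} (hg : ∀ t, g t ∈ Set.Icc (0 : ℝ) 1)
    (hsum : Tendsto (fun n => ∑ t ∈ Finset.range n, g t) atTop atTop) {B : ℝ}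
    (h : ∀ᶠ t in atTop, |y (t + 1)| ≤ (1 - g t) * |y t| + g t * B) {ε : ℝ} (hε : 0 < ε) :
    ∀ᶠ t in atTop, |y t| ≤ B + ε := by
  have := tendsto_zero_of_le_one_sub_mul (u := fun t => max (|y t| - B) 0)
    (fun t => le_max_right _ _) hsum (by
      filter_upwards [h] with t ht
      have h1 := mul_le_mul_of_nonneg_left (le_max_left (|y t| - B) 0) (sub_nonneg.2 (hg t).2)
      exact max_le (by linarith)
        (mul_nonneg (sub_nonneg.2 (hg t).2) (le_max_right _ _)))
  filter_upwards [this.eventually_le_const hε] with t ht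
  linarith [le_max_left (|y t| - B) 0]

/-- Deterministic convergence theorem for asynchronous stochastic approximation of the fixed point
of a sup-norm contraction, with noise terms `w` for which `∑ g w` converges. -/
theorem tendsto_zero_of_asynchronous_contraction {ι : Type*} [Finite ι] {α : ℝ} (hα0 : 0 < α)
    (hα1 : α < 1) {g z h w : ℕ → ι → ℝ} (hg : ∀ t i, g t i ∈ Set.Icc (0 : ℝ) 1)
    (hsum : ∀ i, Tendsto (fun n => ∑ t ∈ Finset.range n, g t i) atTop atTop)
    (hz : ∀ t i, z (t + 1) i = (1 - g t i) * z t i + g t i * (h t i + w t i))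
    (hbd : ∃ C, ∀ t i, |z t i| ≤ C)
    (hh : ∀ t c, (∀ i, |z t i| ≤ c) → ∀ i, |h t i| ≤ α * c)
    (hw : ∀ i, ∃ l, Tendsto (fun n => ∑ t ∈ Finset.range n, g t i * w t i) atTop (𝓝 l)) (i : ι) :
    Tendsto (fun t => z t i) atTop (𝓝 0) := by
  choose l hl using hw
  have step : ∀ D δ : ℝ, 0 < δ → (∀ᶠ t in atTop, ∀ i, |z t i| ≤ D) →
      ∀ᶠ t in atTop, ∀ i, |z t i| ≤ α * D + δ := by
    intro D δ hδ hD
    rw [eventually_all]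
    intro i
    -- `N` is the remaining noise, which tends to zero. Adding it to `z` cancels `w`: the sum
    -- follows the same averaging recursion with `h + N` in place of `h + w`.
    set N : ℕ → ℝ := fun n => l i - ∑ t ∈ Finset.range n, g t i * w t i with hN
    have hN0 : Tendsto N atTop (𝓝 0) := by
      simpa using (hl i).const_sub (l i)
    have hNs : ∀ᶠ t in atTop, |N t| ≤ δ / 3 := by
      have := hN0.abs
      rw [abs_zero] at this
      exact this.eventually_le_const (by positivity)
    have hy : ∀ᶠ t in atTop, |z t i + N t| ≤ (α * D + δ / 3) + δ / 3 := by
      refine eventually_abs_le_add_of_averaging (fun t => hg t i) (hsum i) ?_ (by positivity)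
      filter_upwards [hD, hNs] with t ht hNt
      have e : z (t + 1) i + N (t + 1) = (1 - g t i) * (z t i + N t) + g t i * (h t i + N t) := by
        simp only [hN, hz, Finset.sum_range_succ]; ring
      rw [e]
      refine (abs_add_le _ _).trans ?_
      rw [abs_mul, abs_mul, abs_of_nonneg (sub_nonneg.2 (hg t i).2), abs_of_nonneg (hg t i).1]
      have := hh t D ht i
      have h2 := abs_add_le (h t i) (N t)
      have := mul_le_mul_of_nonneg_left (h2.trans (add_le_add this hNt)) (hg t i).1
      linarith
    filter_upwards [hy, hNs] with t h1 h2
    have : |z t i| ≤ |z t i + N t| + |N t| := by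
      simpa using abs_sub (z t i + N t) (N t)
    linarith
  obtain ⟨C, hC⟩ := hbd
  -- The maximum with 1 keeps `D` positive, so that the slack allowed in each round below is
  -- positive.
  set D : ℝ := max C 1 with hDdef
  have hD : 0 < D := lt_of_lt_of_le one_pos (le_max_right _ _)
  have iter : ∀ n : ℕ, ∀ᶠ t in atTop, ∀ i, |z t i| ≤ ((1 + α) / 2) ^ n * D := by
    intro n
    induction n with
    | zero =>
      refine Eventually.of_forall fun t i => ?_
      rw [pow_zero, one_mul]
      exact (hC t i).trans (le_max_left _ _)
    | succ n ih =>
      have hp : 0 < ((1 + α) / 2) ^ n * D := by positivity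
      -- The slack `(1 - α) / 2` turns the factor `α` into `(1 + α) / 2`, still below 1.
      have := step _ ((1 - α) / 2 * (((1 + α) / 2) ^ n * D))
        (mul_pos (by linarith) hp) ih
      filter_upwards [this] with t ht i
      refine (ht i).trans (le_of_eq ?_)
      ring
  have hpow : Tendsto (fun n : ℕ => ((1 + α) / 2) ^ n * D) atTop (𝓝 0) := by
    simpa using (tendsto_pow_atTop_nhds_zero_of_lt_one (r := (1 + α) / 2) (by linarith)
      (by linarith)).mul_const D
  rw [Metric.tendsto_nhds]
  intro ε hε
  obtain ⟨n, hn⟩ := (hpow.eventually_lt_const hε).exists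
  filter_upwards [iter n] with t ht
  simpa using (ht i).trans_lt hn

/-! ### Conditioning under the path law -/

section PathLaw

variable {X : Type*} [Finite X] [MeasurableSpace X] [DiscreteMeasurableSpace X]

instance (x : X) (p : (t : ℕ) → (Finset.Iic t → X) → ProbabilityMeasure X) :
    IsProbabilityMeasure (pathLaw x p) :=
  inferInstanceAs (IsProbabilityMeasure (Kernel.trajMeasure (X := fun _ => X) _ _))

lemma ae_pathLaw_zero (x : X) (p : (t : ℕ) → (Finset.Iic t → X) → ProbabilityMeasure X) :
    ∀ᵐ ω ∂(pathLaw x p), ω 0 = x := by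
  have h : (pathLaw x p).map (Preorder.frestrictLe (π := fun _ => X) 0) =
      (Measure.dirac x).map (MeasurableEquiv.piUnique (fun _ : Finset.Iic 0 => X)).symm := by
    rw [pathLaw, Kernel.trajMeasure, Measure.map_comp _ _ (by fun_prop),
      Kernel.traj_map_frestrictLe_of_le le_rfl, Measure.deterministic_comp_eq_map]
    exact Measure.map_id
  have h2 : ∀ᵐ f ∂((pathLaw x p).map (Preorder.frestrictLe (π := fun _ => X) 0)),
      f ⟨0, Finset.mem_Iic.2 le_rfl⟩ = x := by
    rw [h, ae_map_iff (MeasurableEquiv.measurable _).aemeasurable MeasurableSet.of_discrete,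
      ae_dirac_iff MeasurableSet.of_discrete]
    rfl
  exact ae_of_ae_map (by fun_prop) h2

lemma integrable_of_dependsOn_history {μ : Measure (ℕ → X)} [IsFiniteMeasure μ] (n : ℕ)
    (f : (Finset.Iic n → X) → ℝ) :
    Integrable (fun ω : ℕ → X => f (Preorder.frestrictLe n ω)) μ := by
  have : Integrable f (μ.map (Preorder.frestrictLe (π := fun _ => X) n)) := .of_finite
  exact this.comp_measurable (by fun_prop)

/-- This is the disintegration of the path law at time `t`. Histories form a finite type, so `f`
needs no regularity. -/
lemma integral_pathLaw_succ (x : X) (p : (t : ℕ) → (Finset.Iic t → X) → ProbabilityMeasure X)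
    (t : ℕ) (f : (Finset.Iic t → X) → X → ℝ) :
    ∫ ω, f (Preorder.frestrictLe t ω) (ω (t + 1)) ∂(pathLaw x p) =
      ∫ ω, ∫ y, f (Preorder.frestrictLe t ω) y ∂(p t (Preorder.frestrictLe t ω) : Measure X)
        ∂(pathLaw x p) := by
  have h := Kernel.map_frestrictLe_trajMeasure_compProd_eq_map_trajMeasure (X := fun _ => X)
    (μ₀ := Measure.dirac x) (κ := historyKernel p) (a := t)
  have hm : Measurable (fun ω : ℕ → X => (Preorder.frestrictLe (π := fun _ => X) t ω, ω (t + 1))) :=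
    by fun_prop
  have e1 := integral_map (μ := pathLaw x p) hm.aemeasurable
    (f := fun q => f q.1 q.2) (measurable_of_finite _).aestronglyMeasurable
  refine e1.symm.trans ?_
  rw [pathLaw, ← h, Measure.integral_compProd .of_finite, integral_map (by fun_prop)
    (measurable_of_finite _).aestronglyMeasurable]
  rfl

end PathLaw

/-! ### Almost sure convergence of the noise martingale -/

/-- The path that follows the history `h` up to time `n` and is constant afterwards. -/
def extendHistory {Y : Type*} {n : ℕ} (h : Finset.Iic n → Y) : ℕ → Y :=
  fun i => h ⟨min i n, Finset.mem_Iic.2 (min_le_right i n)⟩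

lemma extendHistory_frestrictLe {Y : Type*} {n : ℕ} (ω : ℕ → Y) {i : ℕ} (hi : i ≤ n) :
    extendHistory (Preorder.frestrictLe (π := fun _ => Y) n ω) i = ω i := by
  simp [extendHistory, hi]

/-- The sum of the increments `f t (ω 0, …, ω t) (ω (t + 1))` before time `n`. -/
def noiseSum {Y : Type*} (f : (t : ℕ) → (Finset.Iic t → Y) → Y → ℝ) (n : ℕ) (ω : ℕ → Y) : ℝ :=
  ∑ t ∈ Finset.range n, f t (Preorder.frestrictLe t ω) (ω (t + 1))

/-- Exhibits the partial sum as a function of the history up to `n`. For finite state spaces this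
yields adaptedness and integrability. -/
lemma noiseSum_extendHistory {Y : Type*} (f : (t : ℕ) → (Finset.Iic t → Y) → Y → ℝ) (n : ℕ)
    (ω : ℕ → Y) :
    noiseSum f n (extendHistory (Preorder.frestrictLe (π := fun _ => Y) n ω)) =
      noiseSum f n ω := by
  refine Finset.sum_congr rfl fun t ht => ?_
  have ht := Finset.mem_range.1 ht
  congr 1
  · exact funext fun i =>
      extendHistory_frestrictLe ω ((Finset.mem_Iic.1 i.2).trans ht.le)
  · exact extendHistory_frestrictLe ω ht

section Martingale

variable {X : Type*} [Finite X] [MeasurableSpace X] [DiscreteMeasurableSpace X]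
  {x : X} {p : (t : ℕ) → (Finset.Iic t → X) → ProbabilityMeasure X}
  {f : (t : ℕ) → (Finset.Iic t → X) → X → ℝ}

/-- Used with an indicator `G` for the martingale property, and with a multiple of the partial sum
to remove the cross term in the second moment. -/
lemma integral_history_mul_increment
    (hf : ∀ t h, ∫ y, f t h y ∂(p t h : Measure X) = 0) (t : ℕ) (G : (Finset.Iic t → X) → ℝ) :
    ∫ ω, G (Preorder.frestrictLe t ω) * f t (Preorder.frestrictLe t ω) (ω (t + 1))
      ∂(pathLaw x p) = 0 := by
  rw [integral_pathLaw_succ x p t fun h y => G h * f t h y]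
  simp [integral_const_mul, hf]

lemma integrable_noiseSum_history (n : ℕ) (F : ℝ → ℝ) :
    Integrable (fun ω => F (noiseSum f n ω)) (pathLaw x p) := by
  have := integrable_of_dependsOn_history (μ := pathLaw x p) n
    (fun h => F (noiseSum f n (extendHistory h)))
  simpa only [noiseSum_extendHistory] using this

lemma integrable_noiseSum (n : ℕ) : Integrable (noiseSum f n) (pathLaw x p) :=
  integrable_noiseSum_history n id

lemma integrable_increment (t : ℕ) (F : (Finset.Iic t → X) → X → ℝ) :
    Integrable (fun ω => F (Preorder.frestrictLe t ω) (ω (t + 1))) (pathLaw x p) := by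
  have : Integrable (fun q : (Finset.Iic t → X) × X => F q.1 q.2) ((pathLaw x p).map
    (fun ω => (Preorder.frestrictLe (π := fun _ => X) t ω, ω (t + 1)))) := .of_finite
  exact this.comp_measurable (by fun_prop)

lemma martingale_noiseSum (hf : ∀ t h, ∫ y, f t h y ∂(p t h : Measure X) = 0) :
    Martingale (noiseSum f) (Filtration.piLE (X := fun _ : ℕ => X)) (pathLaw x p) := by
  refine martingale_of_setIntegral_eq_succ (fun n => ?_)
    integrable_noiseSum fun n s hs => ?_
  · have e : noiseSum f n = (fun h => noiseSum f n (extendHistory h)) ∘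
        Preorder.frestrictLe (π := fun _ => X) n :=
      funext fun ω => (noiseSum_extendHistory f n ω).symm
    rw [Filtration.piLE_eq_comap_frestrictLe, e]
    exact ((measurable_of_finite _).comp (comap_measurable _)).stronglyMeasurable
  · have hs' := Filtration.piLE.le n s hs
    rw [Filtration.piLE_eq_comap_frestrictLe] at hs
    obtain ⟨S, -, rfl⟩ := hs
    have e : ∀ ω : ℕ → X, noiseSum f (n + 1) ω =
        noiseSum f n ω + f n (Preorder.frestrictLe n ω) (ω (n + 1)) := fun ω =>
      Finset.sum_range_succ _ _
    simp only [e]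
    rw [integral_add (integrable_noiseSum n).integrableOn
      (integrable_increment n _).integrableOn, left_eq_add, ← integral_indicator hs']
    refine Eq.trans ?_ (integral_history_mul_increment (x := x) hf n (S.indicator 1))
    refine integral_congr_ae (Eventually.of_forall fun ω => ?_)
    by_cases h : Preorder.frestrictLe n ω ∈ S <;> simp [Set.indicator, h]

lemma integral_noiseSum_sq_le (hf : ∀ t h, ∫ y, f t h y ∂(p t h : Measure X) = 0) {c : ℕ → ℝ}
    (hc : ∀ t h y, |f t h y| ≤ c t) (n : ℕ) :
    ∫ ω, noiseSum f n ω ^ 2 ∂(pathLaw x p) ≤ ∑ t ∈ Finset.range n, c t ^ 2 := by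
  induction n with
  | zero => simp [noiseSum]
  | succ n ih =>
    have e : ∀ ω : ℕ → X, noiseSum f (n + 1) ω ^ 2 = noiseSum f n ω ^ 2 +
        (2 * noiseSum f n (extendHistory (Preorder.frestrictLe (π := fun _ => X) n ω)) *
          f n (Preorder.frestrictLe n ω) (ω (n + 1)) +
          f n (Preorder.frestrictLe n ω) (ω (n + 1)) ^ 2) := fun ω => by
      rw [noiseSum_extendHistory, noiseSum, Finset.sum_range_succ, ← noiseSum]; ring
    simp only [e]
    have i1 := integrable_increment (x := x) (p := p) n
      (fun h y => 2 * noiseSum f n (extendHistory h) * f n h y)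
    have i2 := integrable_increment (x := x) (p := p) n (fun h y => f n h y ^ 2)
    rw [integral_add (integrable_noiseSum_history n (· ^ 2)) (i1.fun_add i2), integral_add i1 i2,
      integral_history_mul_increment hf n (fun h => 2 * noiseSum f n (extendHistory h)),
      Finset.sum_range_succ, zero_add]
    refine add_le_add ih ?_
    calc _ ≤ ∫ _, c n ^ 2 ∂(pathLaw x p) := integral_mono i2 (integrable_const _) fun ω =>
          sq_le_sq' (neg_le_of_abs_le (hc _ _ _)) (le_of_abs_le (hc _ _ _))
      _ = c n ^ 2 := by simp

/-- Martingale convergence asks for an `L¹` bound; `|s| ≤ 1 + s²` derives it from the second moment.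
-/
lemma integral_norm_noiseSum_le (hf : ∀ t h, ∫ y, f t h y ∂(p t h : Measure X) = 0) {c : ℕ → ℝ}
    (hc : ∀ t h y, |f t h y| ≤ c t) (hs : Summable fun t => c t ^ 2) (n : ℕ) :
    ∫ ω, ‖noiseSum f n ω‖ ∂(pathLaw x p) ≤ 1 + ∑' t, c t ^ 2 := by
  have h1 := integrable_noiseSum_history (x := x) (p := p) (f := f) n (‖·‖)
  have h2 := integrable_noiseSum_history (x := x) (p := p) (f := f) n (· ^ 2)
  have h3 : ∫ ω, ‖noiseSum f n ω‖ ∂(pathLaw x p) ≤ ∫ ω, (1 + noiseSum f n ω ^ 2) ∂(pathLaw x p) :=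
    integral_mono h1 ((integrable_const _).fun_add h2) fun ω => by
      change |noiseSum f n ω| ≤ 1 + noiseSum f n ω ^ 2
      rw [← sq_abs]
      nlinarith [sq_nonneg (|noiseSum f n ω| - 1), abs_nonneg (noiseSum f n ω)]
  have h4 : ∫ ω, (1 + noiseSum f n ω ^ 2) ∂(pathLaw x p) =
      1 + ∫ ω, noiseSum f n ω ^ 2 ∂(pathLaw x p) := by
    rw [integral_add (integrable_const _) h2]; simp
  have h5 := (integral_noiseSum_sq_le (x := x) hf hc n).trans
    (hs.sum_le_tsum _ fun t _ => sq_nonneg _)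
  linarith

theorem ae_tendsto_noiseSum (hf : ∀ t h, ∫ y, f t h y ∂(p t h : Measure X) = 0) {c : ℕ → ℝ}
    (hc : ∀ t h y, |f t h y| ≤ c t) (hs : Summable fun t => c t ^ 2) :
    ∀ᵐ ω ∂(pathLaw x p), ∃ l, Tendsto (fun n => noiseSum f n ω) atTop (𝓝 l) := by
  have hb (n : ℕ) : eLpNorm (noiseSum f n) 1 (pathLaw x p) ≤
      (Real.toNNReal (1 + ∑' t, c t ^ 2) : ENNReal) := by
    rw [eLpNorm_one_eq_lintegral_enorm,
      ← ofReal_integral_norm_eq_lintegral_enorm (integrable_noiseSum n)]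
    exact ENNReal.ofReal_le_ofReal (integral_norm_noiseSum_le hf hc hs n)
  exact (martingale_noiseSum hf).submartingale.exists_ae_tendsto_of_bdd hb

end Martingale

/-! ### Sup-norm nonexpansiveness of suprema, infima and expectations -/

lemma abs_iSup_sub_iSup_le {ι : Type*} [Finite ι] [Nonempty ι] {f g : ι → ℝ} {c : ℝ}
    (h : ∀ i, |f i - g i| ≤ c) : |(⨆ i, f i) - ⨆ i, g i| ≤ c := by
  have key : ∀ f g : ι → ℝ, (∀ i, |f i - g i| ≤ c) → ⨆ i, f i ≤ (⨆ i, g i) + c := fun f g h =>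
    ciSup_le fun i => by
      have := le_ciSup (Set.finite_range g).bddAbove i
      linarith [le_of_abs_le (h i)]
  have h1 := key f g h
  have h2 := key g f fun i => by rw [abs_sub_comm]; exact h i
  exact abs_sub_le_iff.2 ⟨by linarith, by linarith⟩

lemma abs_iInf_sub_iInf_le {ι : Type*} [Finite ι] [Nonempty ι] {f g : ι → ℝ} {c : ℝ}
    (h : ∀ i, |f i - g i| ≤ c) : |(⨅ i, f i) - ⨅ i, g i| ≤ c := by
  have key : ∀ f g : ι → ℝ, (∀ i, |f i - g i| ≤ c) → (⨅ i, f i) - c ≤ ⨅ i, g i := fun f g h =>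
    le_ciInf fun i => by
      have := ciInf_le (Set.finite_range f).bddBelow i
      linarith [le_of_abs_le (h i)]
  have h1 := key f g h
  have h2 := key g f fun i => by rw [abs_sub_comm]; exact h i
  exact abs_sub_le_iff.2 ⟨by linarith, by linarith⟩

lemma exists_forall_abs_le {ι : Type*} [Finite ι] (f : ι → ℝ) : ∃ C, 0 ≤ C ∧ ∀ i, |f i| ≤ C := by
  obtain ⟨C, hC⟩ := (Set.finite_range fun i => |f i|).bddAbove
  exact ⟨max C 0, le_max_right _ _, fun i => (hC ⟨i, rfl⟩).trans (le_max_left _ _)⟩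

lemma abs_integral_le_of_abs_le {Ω : Type*} [MeasurableSpace Ω] (μ : Measure Ω)
    [IsProbabilityMeasure μ] {f : Ω → ℝ} {c : ℝ} (h : ∀ ω, |f ω| ≤ c) : |∫ ω, f ω ∂μ| ≤ c := by
  have := norm_integral_le_of_norm_le_const (μ := μ) (f := f) (Eventually.of_forall h)
  rwa [probReal_univ, mul_one] at this

lemma abs_integral_sub_integral_le {X : Type*} [Finite X] [MeasurableSpace X]
    [DiscreteMeasurableSpace X] (μ : ProbabilityMeasure X) {f g : X → ℝ} {c : ℝ}
    (h : ∀ y, |f y - g y| ≤ c) :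
    |∫ y, f y ∂(μ : Measure X) - ∫ y, g y ∂(μ : Measure X)| ≤ c := by
  rw [← integral_sub .of_finite .of_finite]
  exact abs_integral_le_of_abs_le _ h

/-! ### The robust Bellman equation -/

section DynamicProgramming

variable {X A : Type*} [MeasurableSpace X] {N : ℕ}

/-- The worst-case expectation of `r(x, a, Y) + α v(Y)`. -/
noncomputable def worstMean (M : Model X A N) (v : X → ℝ) (x : X) (a : A) : ℝ :=
  ⨅ k : Fin N, ∫ y, (M.r x a y + M.α * v y) ∂(M.P k x a : Measure X)

variable {M : Model X A N}

/-- The rewards collected along `ω` before time `n`, continued with the terminal reward `v`. -/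
def truncatedReturn (M : Model X A N) (v : X → ℝ) (a : Policy X A) (ω : ℕ → X) (n : ℕ) : ℝ :=
  ∑ t ∈ Finset.range n, M.α ^ t * M.r (ω t) (a t (ω t)) (ω (t + 1)) + M.α ^ n * v (ω n)

lemma truncatedReturn_succ (v : X → ℝ) (a : Policy X A) (ω : ℕ → X) (n : ℕ) :
    truncatedReturn M v a ω (n + 1) = truncatedReturn M v a ω n +
      M.α ^ n * (M.r (ω n) (a n (ω n)) (ω (n + 1)) + M.α * v (ω (n + 1)) - v (ω n)) := by
  simp only [truncatedReturn, Finset.sum_range_succ]; ring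

lemma truncatedReturn_extendHistory (v : X → ℝ) (a : Policy X A) (ω : ℕ → X) (n : ℕ) :
    truncatedReturn M v a (extendHistory (Preorder.frestrictLe (π := fun _ => X) n ω)) n =
      truncatedReturn M v a ω n := by
  simp only [truncatedReturn, extendHistory_frestrictLe ω le_rfl]
  congr 1
  refine Finset.sum_congr rfl fun t ht => ?_
  have ht := Finset.mem_range.1 ht
  rw [extendHistory_frestrictLe ω ht.le, extendHistory_frestrictLe ω ht]

lemma summable_discounted {R : ℝ} (hα0 : 0 ≤ M.α) (hα1 : M.α < 1) (hR : ∀ x a y, |M.r x a y| ≤ R)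
    (a : Policy X A) (ω : ℕ → X) :
    Summable (fun t : ℕ => M.α ^ t * M.r (ω t) (a t (ω t)) (ω (t + 1))) ∧
      |∑' t : ℕ, M.α ^ t * M.r (ω t) (a t (ω t)) (ω (t + 1))| ≤ (1 - M.α)⁻¹ * R := by
  have hb : ∀ t : ℕ, ‖M.α ^ t * M.r (ω t) (a t (ω t)) (ω (t + 1))‖ ≤ M.α ^ t * R := fun t => by
    rw [norm_mul, norm_pow, Real.norm_of_nonneg hα0]
    exact mul_le_mul_of_nonneg_left (hR _ _ _) (pow_nonneg hα0 t)
  have hg := (hasSum_geometric_of_lt_one hα0 hα1).mul_right R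
  exact ⟨.of_norm_bounded hg.summable hb, tsum_of_norm_bounded hg hb⟩

variable [Finite X] [DiscreteMeasurableSpace X]

lemma Qstar_eq_worstMean (M : Model X A N) (x : X) (a : A) :
    Qstar M x a = worstMean M (value M) x a :=
  iInf_range' (fun μ : ProbabilityMeasure X => ∫ y, (M.r x a y + M.α * value M y) ∂(μ : Measure X))
    fun k => M.P k x a

lemma abs_worstMean_sub_le [Nonempty (Fin N)] (hα : 0 ≤ M.α) {v w : X → ℝ} {c : ℝ}
    (h : ∀ y, |v y - w y| ≤ c) (x : X) (a : A) :
    |worstMean M v x a - worstMean M w x a| ≤ M.α * c :=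
  abs_iInf_sub_iInf_le fun k => abs_integral_sub_integral_le _ fun y => by
    rw [add_sub_add_left_eq_sub, ← mul_sub, abs_mul, abs_of_nonneg hα]
    exact mul_le_mul_of_nonneg_left (h y) hα

lemma nonempty_admissibleLaws [Nonempty (Fin N)] (x : X) (a : Policy X A) :
    (admissibleLaws M x a).Nonempty :=
  ⟨_, fun t y => M.P (Classical.arbitrary _) y (a t y), fun _ _ => ⟨_, rfl⟩, rfl⟩

/-- Banach's fixed point theorem on `X → ℝ` with the sup norm. -/
lemma exists_bellman_fixedPoint [Finite A] [Nonempty A] [Nonempty (Fin N)] (hα0 : 0 ≤ M.α)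
    (hα1 : M.α < 1) : ∃ v : X → ℝ, ∀ x, ⨆ a, worstMean M v x a = v x := by
  have := Fintype.ofFinite X
  have hT : ContractingWith M.α.toNNReal fun (v : X → ℝ) x => ⨆ a, worstMean M v x a := by
    refine ⟨by simpa using hα1, LipschitzWith.of_dist_le_mul fun v w => ?_⟩
    rw [Real.coe_toNNReal _ hα0, dist_pi_le_iff (by positivity)]
    exact fun x => abs_iSup_sub_iSup_le fun a =>
      abs_worstMean_sub_le hα0 (fun y => dist_le_pi_dist v w y) x a
  exact ⟨hT.fixedPoint _, fun x => congrFun hT.fixedPoint_isFixedPt x⟩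

lemma integrable_truncatedReturn (v : X → ℝ) (a : Policy X A) (n : ℕ) {μ : Measure (ℕ → X)}
    [IsFiniteMeasure μ] : Integrable (fun ω => truncatedReturn M v a ω n) μ := by
  have := integrable_of_dependsOn_history (μ := μ) n
    (fun h => truncatedReturn M v a (extendHistory h) n)
  simpa only [truncatedReturn_extendHistory] using this

/-- The increment is the discounted mean of the one-step Bellman defect, so a sign of the defect
makes the expected truncated returns monotone in `n`. -/
lemma integral_truncatedReturn_succ (v : X → ℝ) (a : Policy X A) (x : X)
    (p : ℕ → X → ProbabilityMeasure X) (n : ℕ) :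
    ∫ ω, truncatedReturn M v a ω (n + 1)
        ∂(pathLaw x fun t h => p t (h ⟨t, Finset.mem_Iic.2 le_rfl⟩)) =
      ∫ ω, truncatedReturn M v a ω n
        ∂(pathLaw x fun t h => p t (h ⟨t, Finset.mem_Iic.2 le_rfl⟩)) +
      M.α ^ n * ∫ ω, (∫ y, (M.r (ω n) (a n (ω n)) y + M.α * v y) ∂(p n (ω n) : Measure X) - v (ω n))
        ∂(pathLaw x fun t h => p t (h ⟨t, Finset.mem_Iic.2 le_rfl⟩)) := by
  set q : (t : ℕ) → (Finset.Iic t → X) → ProbabilityMeasure X :=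
    fun t h => p t (h ⟨t, Finset.mem_Iic.2 le_rfl⟩)
  let f : (Finset.Iic n → X) → X → ℝ := fun h y =>
    M.r (h ⟨n, Finset.mem_Iic.2 le_rfl⟩) (a n (h ⟨n, Finset.mem_Iic.2 le_rfl⟩)) y + M.α * v y -
      v (h ⟨n, Finset.mem_Iic.2 le_rfl⟩)
  have h1 := integral_pathLaw_succ x q n f
  have h2 := integrable_increment (x := x) (p := q) n f
  simp only [truncatedReturn_succ]
  refine (integral_add (integrable_truncatedReturn v a n) (h2.const_mul (M.α ^ n))).trans ?_
  rw [integral_const_mul]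
  congr 2
  refine h1.trans (integral_congr_ae (Eventually.of_forall fun ω => ?_))
  refine (integral_sub .of_finite (integrable_const _)).trans ?_
  simp only [integral_const, probReal_univ, one_smul]
  rfl

lemma tendsto_integral_truncatedReturn [Finite A] (hα0 : 0 ≤ M.α) (hα1 : M.α < 1) (v : X → ℝ)
    (a : Policy X A) (μ : Measure (ℕ → X)) [IsProbabilityMeasure μ] :
    Tendsto (fun n => ∫ ω, truncatedReturn M v a ω n ∂μ) atTop
      (𝓝 (∫ ω, ∑' t : ℕ, M.α ^ t * M.r (ω t) (a t (ω t)) (ω (t + 1)) ∂μ)) := by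
  obtain ⟨R, hR0, hR⟩ := exists_forall_abs_le fun q : X × A × X => M.r q.1 q.2.1 q.2.2
  obtain ⟨C, hC0, hC⟩ := exists_forall_abs_le v
  have hR : ∀ x a y, |M.r x a y| ≤ R := fun x a y => hR (x, a, y)
  refine tendsto_integral_of_dominated_convergence (fun _ => (1 - M.α)⁻¹ * R + C)
    (fun n => (integrable_truncatedReturn v a n).aestronglyMeasurable) (integrable_const _)
    (fun n => Eventually.of_forall fun ω => ?_) (Eventually.of_forall fun ω => ?_)
  · refine (norm_add_le _ _).trans (add_le_add ?_ ?_)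
    · have hg := hasSum_geometric_of_lt_one hα0 hα1
      calc _ ≤ ∑ t ∈ Finset.range n, M.α ^ t * R := norm_sum_le_of_le _ fun t _ => by
            rw [norm_mul, norm_pow, Real.norm_of_nonneg hα0]
            exact mul_le_mul_of_nonneg_left (hR _ _ _) (pow_nonneg hα0 t)
        _ ≤ (1 - M.α)⁻¹ * R :=
            sum_le_hasSum _ (fun t _ => by positivity) (hg.mul_right R)
    · rw [norm_mul, norm_pow, Real.norm_of_nonneg hα0]
      exact (mul_le_of_le_one_left (norm_nonneg _) (pow_le_one₀ hα0 hα1.le)).trans (hC _)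
  · have h1 := (summable_discounted hα0 hα1 hR a ω).1.hasSum.tendsto_sum_nat
    have h2 : Tendsto (fun n => M.α ^ n * v (ω n)) atTop (𝓝 0) := by
      refine squeeze_zero_norm (fun n => ?_)
        (by simpa using (tendsto_pow_atTop_nhds_zero_of_lt_one hα0 hα1).mul_const C)
      rw [norm_mul, norm_pow, Real.norm_of_nonneg hα0]
      exact mul_le_mul_of_nonneg_left (hC _) (pow_nonneg hα0 n)
    simpa [truncatedReturn] using h1.add h2

lemma integral_truncatedReturn_zero (v : X → ℝ) (a : Policy X A) (x : X)
    (p : (t : ℕ) → (Finset.Iic t → X) → ProbabilityMeasure X) :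
    ∫ ω, truncatedReturn M v a ω 0 ∂(pathLaw x p) = v x := by
  have : (fun ω => truncatedReturn M v a ω 0) =ᵐ[pathLaw x p] fun _ => v x := by
    filter_upwards [ae_pathLaw_zero x p] with ω hω
    simp [truncatedReturn, hω]
  rw [integral_congr_ae this]
  simp

variable [Finite A]

/-- The expected truncated returns start at `v x`, do not increase, and converge to the expected
full return. -/
lemma integral_return_le (hα0 : 0 ≤ M.α) (hα1 : M.α < 1) {v : X → ℝ} {a : Policy X A}
    {p : ℕ → X → ProbabilityMeasure X}
    (h : ∀ t y, ∫ z, (M.r y (a t y) z + M.α * v z) ∂(p t y : Measure X) ≤ v y) (x : X) :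
    ∫ ω, ∑' t : ℕ, M.α ^ t * M.r (ω t) (a t (ω t)) (ω (t + 1))
      ∂(pathLaw x fun t h => p t (h ⟨t, Finset.mem_Iic.2 le_rfl⟩)) ≤ v x := by
  refine le_of_tendsto (tendsto_integral_truncatedReturn hα0 hα1 v a _)
    (Eventually.of_forall fun n => ?_)
  induction n with
  | zero => exact (integral_truncatedReturn_zero v a x _).le
  | succ n ih =>
    rw [integral_truncatedReturn_succ]
    have := mul_nonpos_of_nonneg_of_nonpos (pow_nonneg hα0 n)
      (integral_nonpos (μ := pathLaw x fun t h => p t (h ⟨t, Finset.mem_Iic.2 le_rfl⟩))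
        fun ω => sub_nonpos.2 (h n (ω n)))
    linarith

lemma le_integral_return (hα0 : 0 ≤ M.α) (hα1 : M.α < 1) {v : X → ℝ} {a : Policy X A}
    {p : ℕ → X → ProbabilityMeasure X}
    (h : ∀ t y, v y ≤ ∫ z, (M.r y (a t y) z + M.α * v z) ∂(p t y : Measure X)) (x : X) :
    v x ≤ ∫ ω, ∑' t : ℕ, M.α ^ t * M.r (ω t) (a t (ω t)) (ω (t + 1))
      ∂(pathLaw x fun t h => p t (h ⟨t, Finset.mem_Iic.2 le_rfl⟩)) := by
  refine ge_of_tendsto (tendsto_integral_truncatedReturn hα0 hα1 v a _)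
    (Eventually.of_forall fun n => ?_)
  induction n with
  | zero => exact (integral_truncatedReturn_zero v a x _).ge
  | succ n ih =>
    rw [integral_truncatedReturn_succ]
    have := mul_nonneg (pow_nonneg hα0 n)
      (integral_nonneg (μ := pathLaw x fun t h => p t (h ⟨t, Finset.mem_Iic.2 le_rfl⟩))
        fun ω => sub_nonneg.2 (h n (ω n)))
    linarith

/-- The expected discounted reward of the policy `a` when the states have law `μ`. -/
noncomputable def expectedReturn (M : Model X A N) (a : Policy X A) (μ : Measure (ℕ → X)) : ℝ :=
  ∫ ω, ∑' t : ℕ, M.α ^ t * M.r (ω t) (a t (ω t)) (ω (t + 1)) ∂μ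

/-- A real infimum is meaningful only over a set bounded below; the geometric series supplies the
bound. -/
lemma bddBelow_expectedReturn (hα0 : 0 ≤ M.α) (hα1 : M.α < 1) (x : X) (a : Policy X A) :
    BddBelow (Set.range fun μ : admissibleLaws M x a =>
      expectedReturn M a (μ : Measure (ℕ → X))) := by
  obtain ⟨R, hR0, hR⟩ := exists_forall_abs_le fun q : X × A × X => M.r q.1 q.2.1 q.2.2
  refine ⟨-((1 - M.α)⁻¹ * R), ?_⟩
  rintro _ ⟨⟨_, p, hp, rfl⟩, rfl⟩
  exact neg_le_of_abs_le (abs_integral_le_of_abs_le _ fun ω =>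
    (summable_discounted hα0 hα1 (fun x a y => hR (x, a, y)) a ω).2)

/-- Nature answers each state-action pair with a minimising index. Such a response depends on time
and current state only, so its law is admissible. -/
lemma iInf_expectedReturn_le [Nonempty (Fin N)] (hα0 : 0 ≤ M.α) (hα1 : M.α < 1) {v : X → ℝ}
    (hv : ∀ x, ⨆ a, worstMean M v x a = v x) (x : X) (a : Policy X A) :
    ⨅ μ : admissibleLaws M x a, expectedReturn M a (μ : Measure (ℕ → X)) ≤ v x := by
  have hk : ∀ y b, ∃ k : Fin N,
      ∫ z, (M.r y b z + M.α * v z) ∂(M.P k y b : Measure X) = worstMean M v y b :=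
    fun y b => exists_eq_ciInf_of_finite
  choose k hk using hk
  have hle : ∀ t y, ∫ z, (M.r y (a t y) z + M.α * v z) ∂(M.P (k y (a t y)) y (a t y) : Measure X)
      ≤ v y := fun t y => by
    rw [hk, ← hv y]
    exact le_ciSup (f := fun b => worstMean M v y b) (Set.finite_range _).bddAbove (a t y)
  have h := ciInf_le (bddBelow_expectedReturn hα0 hα1 x a)
    ⟨_, fun t y => M.P (k y (a t y)) y (a t y), fun _ _ => ⟨_, rfl⟩, rfl⟩
  exact h.trans (integral_return_le hα0 hα1 hle x)

/-- The stationary greedy policy works: whatever measure nature picks, the one-step mean is at least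
`worstMean` at the maximising action, which is `v`. -/
lemma exists_policy_le_iInf_expectedReturn [Nonempty A] [Nonempty (Fin N)] (hα0 : 0 ≤ M.α)
    (hα1 : M.α < 1) {v : X → ℝ} (hv : ∀ x, ⨆ a, worstMean M v x a = v x) :
    ∃ a : Policy X A, ∀ x,
      v x ≤ ⨅ μ : admissibleLaws M x a, expectedReturn M a (μ : Measure (ℕ → X)) := by
  have hb : ∀ y, ∃ b, worstMean M v y b = ⨆ b, worstMean M v y b :=
    fun y => exists_eq_ciSup_of_finite
  choose b hb using hb
  refine ⟨fun _ => b, fun x => ?_⟩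
  have := (nonempty_admissibleLaws (M := M) x fun _ => b).to_subtype
  refine le_ciInf ?_
  rintro ⟨_, p, hp, rfl⟩
  have hle : ∀ (t : ℕ) y, v y ≤ ∫ z, (M.r y (b y) z + M.α * v z) ∂(p t y : Measure X) := by
    intro t y
    obtain ⟨k, hk⟩ := hp t y
    rw [← hk, ← hv y, ← hb y]
    exact ciInf_le (Set.finite_range _).bddBelow k
  exact le_integral_return hα0 hα1 (a := fun _ => b) hle x

/-- The robust value function is the solution of the robust Bellman equation. -/
theorem value_eq_of_bellman [Nonempty A] [Nonempty (Fin N)] (hα0 : 0 ≤ M.α) (hα1 : M.α < 1)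
    {v : X → ℝ} (hv : ∀ x, ⨆ a, worstMean M v x a = v x) : value M = v := by
  funext x
  obtain ⟨b, hb⟩ := exists_policy_le_iInf_expectedReturn hα0 hα1 hv
  have hupper := iInf_expectedReturn_le hα0 hα1 hv x
  change ⨆ a : Policy X A, ⨅ μ : admissibleLaws M x a,
    expectedReturn M a (μ : Measure (ℕ → X)) = v x
  refine le_antisymm (ciSup_le hupper) (le_ciSup_of_le ⟨v x, ?_⟩ b (hb x))
  rintro _ ⟨a, rfl⟩
  exact hupper a

theorem value_eq_iSup_Qstar [Nonempty A] [Nonempty (Fin N)] (hα0 : 0 ≤ M.α) (hα1 : M.α < 1)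
    (x : X) : value M x = ⨆ b, Qstar M x b := by
  obtain ⟨v, hv⟩ := exists_bellman_fixedPoint (M := M) hα0 hα1
  simp only [Qstar_eq_worstMean, value_eq_of_bellman hα0 hα1 hv, hv]

end DynamicProgramming

/-! ### Effective learning rates -/

section LearningRate

variable {X A : Type*} {a : Policy X A} {γ : ℕ → ℝ}

lemma learningRate_mem_Icc (hγ : ∀ t, γ t ∈ Set.Icc (0 : ℝ) 1) (t : ℕ) (x : X) (b : A) (y : X) :
    learningRate a γ t x b y ∈ Set.Icc (0 : ℝ) 1 := by
  unfold learningRate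
  split_ifs
  · exact hγ t
  · simp

lemma learningRate_le (hγ : ∀ t, γ t ∈ Set.Icc (0 : ℝ) 1) (t : ℕ) (x : X) (b : A) (y : X) :
    learningRate a γ t x b y ≤ γ t := by
  unfold learningRate
  split_ifs
  · exact le_rfl
  · exact (hγ t).1

/-- Exactly one pair is visited at each time, so `γ t ^ 2` is the finite sum of the squared
effective rates over all pairs. -/
lemma summable_sq_of_learningRate [Finite X] [Finite A] {ω : ℕ → X}
    (h : ∀ x b, Summable fun t => learningRate a γ t x b (ω t) ^ 2) :
    Summable fun t => γ t ^ 2 := by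
  classical
  have := Fintype.ofFinite X
  have := Fintype.ofFinite A
  refine (summable_sum fun (q : X × A) (_ : q ∈ Finset.univ) => h q.1 q.2).congr fun t => ?_
  rw [Finset.sum_eq_single (ω t, a t (ω t))]
  · simp [learningRate]
  · intro q _ hq
    simp [learningRate, hq]
  · simp

end LearningRate

/-! ### Boundedness of the iterates -/

section Iterates

variable {X A : Type*} [MeasurableSpace X] {N : ℕ} {M : Model X A N} {a : Policy X A} {γ : ℕ → ℝ}
  {Q₀ : X → A → ℝ}

lemma Qiter_succ (ω : ℕ → X) (t : ℕ) (x : X) (b : A) :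
    Qiter M a γ Q₀ ω (t + 1) x b =
      (1 - learningRate a γ t x b (ω t)) * Qiter M a γ Q₀ ω t x b +
        learningRate a γ t x b (ω t) * target M (Qiter M a γ Q₀ ω t) x b (ω (t + 1)) := by
  simp only [Qiter, learningRate]
  split_ifs <;> ring

lemma Qiter_congr {ω ω' : ℕ → X} {t : ℕ} (h : ∀ i ≤ t, ω i = ω' i) :
    Qiter M a γ Q₀ ω t = Qiter M a γ Q₀ ω' t := by
  induction t with
  | zero => rfl
  | succ t ih =>
    funext x b
    rw [Qiter_succ, Qiter_succ, ih fun i hi => h i (hi.trans t.le_succ), h t t.le_succ,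
      h (t + 1) le_rfl]

lemma abs_target_le [Finite A] [Nonempty A] (hα : 0 ≤ M.α) {R B : ℝ}
    (hR : ∀ x a y, |M.r x a y| ≤ R) {q : X → A → ℝ} (hq : ∀ x b, |q x b| ≤ B) (x : X) (b : A)
    (y : X) : |target M q x b y| ≤ R + M.α * B := by
  have h : |⨆ c, q y c| ≤ B := by
    simpa using abs_iSup_sub_iSup_le (f := q y) (g := 0) (c := B) fun c => by simpa using hq y c
  refine (abs_add_le _ _).trans (add_le_add (hR _ _ _) ?_)
  rw [abs_mul, abs_of_nonneg hα]
  exact mul_le_mul_of_nonneg_left h hα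

/-- The condition `hRB` makes the ball of radius `B` invariant, each update being a convex
combination of an old entry and a target. -/
lemma abs_Qiter_le [Finite A] [Nonempty A] (hα : 0 ≤ M.α)
    (hγ : ∀ t, γ t ∈ Set.Icc (0 : ℝ) 1) {R B : ℝ} (hR : ∀ x a y, |M.r x a y| ≤ R)
    (hB : ∀ x b, |Q₀ x b| ≤ B) (hRB : R + M.α * B ≤ B) (ω : ℕ → X) (t : ℕ) (x : X) (b : A) :
    |Qiter M a γ Q₀ ω t x b| ≤ B := by
  induction t generalizing x b with
  | zero => exact hB x b
  | succ t ih =>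
    have hg := learningRate_mem_Icc (a := a) hγ t x b (ω t)
    have h1 := mul_le_mul_of_nonneg_left (ih x b) (sub_nonneg.2 hg.2)
    have h2 := mul_le_mul_of_nonneg_left
      ((abs_target_le hα hR ih x b (ω (t + 1))).trans hRB) hg.1
    rw [Qiter_succ]
    refine (abs_add_le _ _).trans ?_
    rw [abs_mul, abs_mul, abs_of_nonneg (sub_nonneg.2 hg.2), abs_of_nonneg hg.1]
    linarith

lemma exists_abs_Qiter_target_le [Finite X] [Finite A] [Nonempty A] (hα0 : 0 ≤ M.α)
    (hα1 : M.α < 1) (hγ : ∀ t, γ t ∈ Set.Icc (0 : ℝ) 1) (Q₀ : X → A → ℝ) (a : Policy X A) :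
    ∃ B, ∀ ω t x b, |Qiter M a γ Q₀ ω t x b| ≤ B ∧
      ∀ y, |target M (Qiter M a γ Q₀ ω t) x b y| ≤ B := by
  obtain ⟨R, -, hR⟩ := exists_forall_abs_le fun q : X × A × X => M.r q.1 q.2.1 q.2.2
  obtain ⟨C, -, hC⟩ := exists_forall_abs_le fun q : X × A => Q₀ q.1 q.2
  have hR : ∀ x a y, |M.r x a y| ≤ R := fun x a y => hR (x, a, y)
  -- `R / (1 - α)` is the least `B` with `R + α B ≤ B`; `C` accounts for the initial values.
  set B := max C (R / (1 - M.α))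
  have hRB : R + M.α * B ≤ B := by
    have := (div_le_iff₀ (sub_pos.2 hα1)).1 (le_max_right C (R / (1 - M.α)))
    linarith
  have hQ := abs_Qiter_le (M := M) (a := a) hα0 hγ hR
    (fun x b => (hC (x, b)).trans (le_max_left _ _)) hRB
  exact ⟨B, fun ω t x b => ⟨hQ ω t x b, fun y =>
    (abs_target_le hα0 hR (hQ ω t) x b y).trans hRB⟩⟩

end Iterates

/-! ### The sampling noise of the algorithm -/

section Noise

variable {X A : Type*} [MeasurableSpace X] {N : ℕ}

/-- The law of `X_{t+1}` given the history `h` in the algorithm. -/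
def samplingLaw (M : Model X A N) (a : Policy X A) (k : (t : ℕ) → (Finset.Iic t → X) → Fin N)
    (t : ℕ) (h : Finset.Iic t → X) : ProbabilityMeasure X :=
  M.P (k t h) (h ⟨t, Finset.mem_Iic.2 le_rfl⟩) (a t (h ⟨t, Finset.mem_Iic.2 le_rfl⟩))

/-- The centred and weighted one-step target by which the algorithm moves the entry `(x, b)`. -/
noncomputable def noise (M : Model X A N) (a : Policy X A) (γ : ℕ → ℝ) (Q₀ : X → A → ℝ)
    (k : (t : ℕ) → (Finset.Iic t → X) → Fin N) (x : X) (b : A) (t : ℕ) (h : Finset.Iic t → X)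
    (y : X) : ℝ :=
  learningRate a γ t x b (h ⟨t, Finset.mem_Iic.2 le_rfl⟩) *
    (target M (Qiter M a γ Q₀ (extendHistory h) t) x b y -
      ∫ z, target M (Qiter M a γ Q₀ (extendHistory h) t) x b z ∂(samplingLaw M a k t h : Measure X))

variable {M : Model X A N} {a : Policy X A} {γ : ℕ → ℝ}
  {Q₀ : X → A → ℝ} {k : (t : ℕ) → (Finset.Iic t → X) → Fin N}

lemma abs_noise_le (hγ : ∀ t, γ t ∈ Set.Icc (0 : ℝ) 1) {B : ℝ}
    (hB : ∀ ω t x b, ∀ y, |target M (Qiter M a γ Q₀ ω t) x b y| ≤ B) (x : X) (b : A) (t : ℕ)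
    (h : Finset.Iic t → X) (y : X) : |noise M a γ Q₀ k x b t h y| ≤ γ t * (B + B) := by
  rw [noise, abs_mul, abs_of_nonneg (learningRate_mem_Icc hγ _ _ _ _).1]
  refine mul_le_mul (learningRate_le hγ _ _ _ _) ((abs_sub _ _).trans
    (add_le_add (hB _ _ _ _ _) (abs_integral_le_of_abs_le _ fun z => hB _ _ _ _ z)))
    (abs_nonneg _) (hγ t).1

/-- At the visited pair the selected index attains the infimum in `worstMean`; at other pairs the
rate vanishes, so the centring is immaterial. Centring `noise` by the sampling law gives mean zero
for every history, whereas this identity needs paths starting at `x₀`. -/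
lemma noise_frestrictLe {x₀ : X} (hk : IsSelectionRule M x₀ a γ Q₀ k) {ω : ℕ → X} (hω : ω 0 = x₀)
    (x : X) (b : A) (t : ℕ) (y : X) :
    noise M a γ Q₀ k x b t (Preorder.frestrictLe t ω) y = learningRate a γ t x b (ω t) *
      (target M (Qiter M a γ Q₀ ω t) x b y -
        worstMean M (fun z => ⨆ c, Qiter M a γ Q₀ ω t z c) x b) := by
  have hQ : Qiter M a γ Q₀ (extendHistory (Preorder.frestrictLe (π := fun _ => X) t ω)) t =
      Qiter M a γ Q₀ ω t := Qiter_congr fun i hi => extendHistory_frestrictLe ω hi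
  rw [noise, hQ]
  change learningRate a γ t x b (ω t) * _ = _
  by_cases h : (x, b) = (ω t, a t (ω t))
  · obtain ⟨rfl, rfl⟩ := Prod.mk.inj h
    congr 2
    have := Fin.pos_iff_nonempty.1 (k t fun i => ω i).pos
    exact le_antisymm (le_ciInf (hk ω hω t))
      (ciInf_le (Set.finite_range fun j : Fin N => ∫ z, target M (Qiter M a γ Q₀ ω t) (ω t)
        (a t (ω t)) z ∂(M.P j (ω t) (a t (ω t)) : Measure X)).bddBelow (k t fun i => ω i))
  · simp [learningRate, h]

lemma integral_noise [Finite X] [DiscreteMeasurableSpace X] (x : X) (b : A) (t : ℕ)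
    (h : Finset.Iic t → X) :
    ∫ y, noise M a γ Q₀ k x b t h y ∂(samplingLaw M a k t h : Measure X) = 0 := by
  simp only [noise]
  rw [integral_const_mul, integral_sub .of_finite (integrable_const _)]
  simp

end Noise

end RobustQ

/-! ### Convergence of robust Q-learning -/

theorem theorem3p1 {X A : Type*} [Finite X] [Finite A]
    [MeasurableSpace X] [DiscreteMeasurableSpace X] {N : ℕ}
    (M : RobustQ.Model X A N) (hα0 : 0 < M.α) (hα1 : M.α < 1)
    (γ : ℕ → ℝ) (hγ : ∀ t, γ t ∈ Set.Icc (0 : ℝ) 1)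
    (Q₀ : X → A → ℝ) (x₀ : X) (a : RobustQ.Policy X A)
    (k : (t : ℕ) → (Finset.Iic t → X) → Fin N)
    (hk : RobustQ.IsSelectionRule M x₀ a γ Q₀ k)
    (hrates : ∀ᵐ ω ∂(RobustQ.algorithmLaw M x₀ a k), ∀ (x : X) (b : A),
      Tendsto (fun n : ℕ => ∑ t ∈ Finset.range n, RobustQ.learningRate a γ t x b (ω t))
        atTop atTop ∧
      Summable (fun t : ℕ => RobustQ.learningRate a γ t x b (ω t) ^ 2)) :
    ∀ (x : X) (b : A), ∀ᵐ ω ∂(RobustQ.algorithmLaw M x₀ a k),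
      Tendsto (fun t : ℕ => RobustQ.Qiter M a γ Q₀ ω t x b) atTop (𝓝 (RobustQ.Qstar M x b)) := by
  open RobustQ in
  have : Nonempty A := ⟨a 0 x₀⟩
  have : Nonempty (Fin N) := ⟨k 0 fun _ => x₀⟩
  change ∀ᵐ ω ∂(pathLaw x₀ (samplingLaw M a k)), _ at hrates
  change ∀ x b, ∀ᵐ ω ∂(pathLaw x₀ (samplingLaw M a k)), _
  obtain ⟨B, hB⟩ := exists_abs_Qiter_target_le (M := M) hα0.le hα1 hγ Q₀ a
  obtain ⟨C, -, hC⟩ := exists_forall_abs_le fun q : X × A => Qstar M q.1 q.2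
  -- The rates `γ` are deterministic, so a single good path gives their square summability.
  obtain ⟨ω', hω'⟩ := hrates.exists
  have hs : Summable fun t => (γ t * (B + B)) ^ 2 := by
    simpa only [mul_pow] using
      (summable_sq_of_learningRate fun x b => (hω' x b).2).mul_right ((B + B) ^ 2)
  have hnoise : ∀ᵐ ω ∂(pathLaw x₀ (samplingLaw M a k)), ∀ q : X × A,
      ∃ l, Tendsto (fun n => noiseSum (noise M a γ Q₀ k q.1 q.2) n ω) atTop (𝓝 l) :=
    ae_all_iff.2 fun q => ae_tendsto_noiseSum (integral_noise q.1 q.2)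
      (abs_noise_le hγ (fun ω t x b => (hB ω t x b).2) q.1 q.2) hs
  intro x b
  filter_upwards [hrates, hnoise, ae_pathLaw_zero x₀ (samplingLaw M a k)] with ω h1 h2 h0
  have key := tendsto_zero_of_asynchronous_contraction hα0 hα1
    (g := fun t (q : X × A) => learningRate a γ t q.1 q.2 (ω t))
    (z := fun t q => Qiter M a γ Q₀ ω t q.1 q.2 - Qstar M q.1 q.2)
    (h := fun t q => worstMean M (fun z => ⨆ c, Qiter M a γ Q₀ ω t z c) q.1 q.2 - Qstar M q.1 q.2)
    (w := fun t q => target M (Qiter M a γ Q₀ ω t) q.1 q.2 (ω (t + 1)) -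
      worstMean M (fun z => ⨆ c, Qiter M a γ Q₀ ω t z c) q.1 q.2)
    (fun t q => learningRate_mem_Icc hγ t q.1 q.2 (ω t)) (fun q => (h1 q.1 q.2).1)
    (fun t q => by rw [Qiter_succ]; ring)
    ⟨B + C, fun t q => (abs_sub _ _).trans (add_le_add (hB ω t q.1 q.2).1 (hC q))⟩
    (fun t c hc q => by
      rw [Qstar_eq_worstMean]
      refine abs_worstMean_sub_le hα0.le (fun y => ?_) q.1 q.2
      rw [value_eq_iSup_Qstar hα0.le hα1]
      exact abs_iSup_sub_iSup_le fun b => hc (y, b))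
    (fun q => by simpa only [noiseSum, noise_frestrictLe hk h0] using h2 q) (x, b)
  simpa using key.add_const (Qstar M x b)
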